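/- Let $n\ge 3$ and let $C_n\square C_n$ be the toroidal grid, with vertex set $\mathbb Z_n\times\mathbb Z_n$. Its lines are the rows $\{(t,y):t\in\mathbb Z_n\}$ and the columns $\{(x,t):t\in\mathbb Z_n\}$. Let $G$ be a digraph obtained by orienting every edge of $C_n\square C_n$ in such a way that every line becomes a directed $n$-cycle (a straight-ahead orientation). A stream is a non-empty set of cyclically consecutive rows, or of cyclically consecutive columns, that are all oriented in the same direction; its width is its number of lines, and it is maximal if it is not properly contained in another stream. The oriented grid $G$ is $k$-regularly oriented if every maximal stream of $G$ has width exactly $k$. In the game of cops and robbers on a digraph, the cops first choose their initial vertices (several cops may share a vertex), and then the robber chooses his. After that the cops and the robber move alternately, the cops first; a move of a player consists of staying at the current vertex or of going along one arc, in its direction, to an out-neighbour, and all cops move at the same time. The cops win if at some time one of them is at the same vertex as the robber. The cop number $c(G)$ is the minimum number of cops that can guarantee the robber's capture on $G$. Theorem. For every $k\ge 2$, if $G$ is a $k$-regularly oriented toroidal grid, then $c(G)\le 13$. -/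

import Mathlib

/-! ## The game of cops and robbers on a digraph -/

namespace CopsAndRobbers

/-- A single move of a player in the digraph `D`: stay, or traverse one arc. -/
def Move {V : Type*} (D : Digraph V) (u v : V) : Prop :=
  v = u ∨ D.Adj u v

/-- `ForceCapture D p r`: with the cops at the positions `p`, the robber at `r`, and the cops
to move, the cops can force the capture of the robber in finitely many rounds. Either some cop
already is on the robber's vertex, or the cops have a joint legal move `p'` such that either
some cop is now on the robber's vertex, or after every legal answer `r'` of the robber the
cops can still force his capture. -/
inductive ForceCapture {V : Type*} (D : Digraph V) {c : ℕ} : (Fin c → V) → V → Prop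
  | caught {p : Fin c → V} {r : V} (i : Fin c) (h : p i = r) : ForceCapture D p r
  | step {p : Fin c → V} {r : V} (p' : Fin c → V) (hp : ∀ i, Move D (p i) (p' i))
      (h : ∀ r' : V, (∀ i, p' i ≠ r) → Move D r r' → ForceCapture D p' r') :
      ForceCapture D p r

/-- `c` cops win on `D`: they can choose initial positions (several cops may share a vertex)
such that, whatever initial position the robber then chooses, they can force his capture. -/
def CopsWin {V : Type*} (D : Digraph V) (c : ℕ) : Prop :=
  ∃ p : Fin c → V, ∀ r : V, ForceCapture D p r

/-- The cop number: the least number of cops that win on `D` (`⊤` if no finite number does). -/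
noncomputable def copNumber {V : Type*} (D : Digraph V) : ℕ∞ :=
  ⨅ (c : ℕ) (_ : CopsWin D c), (c : ℕ∞)

end CopsAndRobbers

/-! ## Oriented toroidal grids and streams -/

namespace ToroidalGrid

/-- The undirected cycle `C_n` on the vertex set `ℤ/n`. -/
def cycle (n : ℕ) : SimpleGraph (ZMod n) :=
  SimpleGraph.circulantGraph {1}

/-- The toroidal grid `C_n □ C_n`. -/
def grid (n : ℕ) : SimpleGraph (ZMod n × ZMod n) :=
  SimpleGraph.boxProd (cycle n) (cycle n)

/-- `D` is an orientation of the graph `G`: each edge of `G` receives exactly one of its two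
directions, and `D` has no other arcs. -/
def IsOrientation {V : Type*} (D : Digraph V) (G : SimpleGraph V) : Prop :=
  (∀ u v, G.Adj u v ↔ D.Adj u v ∨ D.Adj v u) ∧ ∀ u v, D.Adj u v → ¬ D.Adj v u

/-- The lines of the toroidal grid: the rows and the columns. -/
inductive Line (n : ℕ)
  | row (y : ZMod n)
  | col (x : ZMod n)

/-- The vertex at position `t` of a line. -/
def Line.vertex {n : ℕ} : Line n → ZMod n → ZMod n × ZMod n
  | .row y, t => (t, y)
  | .col x, t => (x, t)

/-- The line `L` is a directed cycle of `D` in the direction of increasing coordinate. -/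
def Forward {n : ℕ} (D : Digraph (ZMod n × ZMod n)) (L : Line n) : Prop :=
  ∀ t, D.Adj (L.vertex t) (L.vertex (t + 1))

/-- The line `L` is a directed cycle of `D` in the direction of decreasing coordinate. -/
def Backward {n : ℕ} (D : Digraph (ZMod n × ZMod n)) (L : Line n) : Prop :=
  ∀ t, D.Adj (L.vertex (t + 1)) (L.vertex t)

/-- A straight-ahead orientation of `C_n □ C_n`: an orientation in which every line is a
directed `n`-cycle. -/
def IsStraightAhead {n : ℕ} (D : Digraph (ZMod n × ZMod n)) : Prop :=
  IsOrientation D (grid n) ∧ ∀ L : Line n, Forward D L ∨ Backward D L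

/-- A set of consecutive lines: for some `a` and some `1 ≤ w ≤ n`, the rows
`a, a + 1, …, a + (w - 1)`, or the columns with these (cyclic) indices. -/
def Consecutive {n : ℕ} (S : Set (Line n)) : Prop :=
  ∃ (a : ZMod n) (w : ℕ), 1 ≤ w ∧ w ≤ n ∧
    (S = {L | ∃ i : ℕ, i < w ∧ L = Line.row (a + (i : ZMod n))} ∨
      S = {L | ∃ i : ℕ, i < w ∧ L = Line.col (a + (i : ZMod n))})

/-- A stream: a set of consecutive lines that are all oriented in the same direction. -/
def IsStream {n : ℕ} (D : Digraph (ZMod n × ZMod n)) (S : Set (Line n)) : Prop :=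
  Consecutive S ∧ ((∀ L ∈ S, Forward D L) ∨ ∀ L ∈ S, Backward D L)

/-- `D` is a `k`-regularly oriented toroidal grid: a straight-ahead orientation of `C_n □ C_n`
in which every stream that is maximal under inclusion has width (number of lines) `k`. -/
def IsRegularlyOriented {n : ℕ} (k : ℕ) (D : Digraph (ZMod n × ZMod n)) : Prop :=
  IsStraightAhead D ∧ ∀ S : Set (Line n), Maximal (IsStream D) S → S.ncard = k

end ToroidalGrid

/-! ## Forcing a goal in a pursuit game -/

/-! If all parallel lines of one class agree in direction, they form one maximal stream and `k = n`,
while a class with both directions forces `k < n`. So both classes are constant or both are mixed.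
In the constant case the grid is an abelian Cayley digraph and three cops win: one follows from
behind, one waits ahead in each direction, and a sum of coefficients drops every round
(`force_cayley`).

In the mixed case the torus is covered by `ℤ × ℤ` with directions alternating in blocks of `k`
(`exists_lineDir_eq`), and a capture modulo `n` suffices. In the diagonal coordinates `sigma`, `tau`
the oriented grid is symmetric under reflection in every line `sigma = 2kz` and `tau = 2kz`. Folding
along these mirrors gives the robber an image confined to a diamond around a vortex, where four cops
catch it (`force_diamond`).

Folding is undone one coordinate at a time, at the cost of two more cops each (`force_caught`). A
cop who has caught a folded image is a reflected or translated copy of the robber and can remain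
one. A reflected copy is a wall: the robber is caught on reaching its mirror. A translated copy
becomes a reflected one when the robber reaches a mirror; until then he is trapped in a strip, where
the folded game catches him. Positions count modulo a period, so one wall already encloses the
robber from both sides, and new walls narrow the enclosure. This uses 4 + 2 + 2 = 8 cops. -/

namespace Pursuit

/-- The cops at `p`, with the robber at `r` and the robber to move, can force a position in `G`.
The robber moves along `R` and every cop moves along `C`. -/
inductive Force {X ι : Type*} (R C : X → X → Prop) (G : (ι → X) → X → Prop) :
    (ι → X) → X → Prop
  | goal {p : ι → X} {r : X} (h : G p r) : Force R C G p r
  | step {p : ι → X} {r : X} (f : X → ι → X) (hf : ∀ r', R r r' → ∀ i, C (p i) (f r' i))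
      (h : ∀ r', R r r' → Force R C G (f r') r') : Force R C G p r

variable {X ι κ : Type*} {R C : X → X → Prop} {G G' : (ι → X) → X → Prop}

theorem Force.of_forall {p : ι → X} {r : X}
    (h : ∀ r', R r r' → ∃ p', (∀ i, C (p i) (p' i)) ∧ Force R C G p' r') : Force R C G p r := by
  classical
  choose f hf using h
  refine .step (fun r' i => if hr : R r r' then f r' hr i else p i) ?_ ?_
  · intro r' hr i
    simpa [hr] using (hf r' hr).1 i
  · intro r' hr
    simpa [hr] using (hf r' hr).2

theorem Force.trans {p : ι → X} {r : X} (h : Force R C G p r)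
    (h' : ∀ p r, G p r → Force R C G' p r) : Force R C G' p r := by
  induction h with
  | goal h => exact h' _ _ h
  | step f hf _ ih => exact .step f hf ih

theorem Force.mono {p : ι → X} {r : X} (h : Force R C G p r) (h' : ∀ p r, G p r → G' p r) :
    Force R C G' p r :=
  h.trans fun p r hG => .goal (h' p r hG)

/-- Lets cops exchange roles, as when a cop who has just become a wall takes over a fixed label. -/
theorem Force.reindex (e : Equiv.Perm ι) (hG : ∀ p r, G (p ∘ e) r → G p r) {p : ι → X} {r : X}
    (h : Force R C G (p ∘ e) r) : Force R C G p r := by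
  generalize hq : p ∘ e = q at h
  induction h generalizing p with
  | goal h => exact .goal (hG _ _ (hq ▸ h))
  | step f hf _ ih =>
    subst hq
    refine .step (fun r' => f r' ∘ e.symm) ?_ ?_
    · intro r' hr i
      simpa using hf r' hr (e.symm i)
    · intro r' hr
      exact ih r' hr (by ext i; simp)

/-- Transport along an automorphism of the game. -/
theorem Force.transport (e : X ≃ X) (hR : ∀ u v, R u v → R (e u) (e v))
    (hC : ∀ u v, C (e u) (e v) → C u v) (hG : ∀ p r, G (e ∘ p) (e r) → G p r)
    {p : ι → X} {r : X} (h : Force R C G (e ∘ p) (e r)) : Force R C G p r := by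
  generalize hq : e ∘ p = q at h
  generalize hs : e r = s at h
  induction h generalizing p r with
  | goal h => subst hq hs; exact .goal (hG _ _ h)
  | step f hf _ ih =>
    subst hq hs
    refine .step (fun r' i => e.symm (f (e r') i)) ?_ ?_
    · intro r' hr i
      exact hC _ _ (by simpa using hf _ (hR _ _ hr) i)
    · intro r' hr
      exact ih _ (hR _ _ hr) (by ext i; simp) rfl

/-- Additional cops keep an invariant `I`, or reach `Q`, while the others force `G`. -/
theorem Force.side (I Q : (κ → X) → X → Prop)
    (hI : ∀ q r r', I q r → R r r' →
      ∃ q' : κ → X, (∀ k, C (q k) (q' k)) ∧ (I q' r' ∨ Q q' r'))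
    {p : ι → X} {q : κ → X} {r : X} (h : Force R C G p r) (hq : I q r) :
    Force R C (fun (P : ι ⊕ κ → X) r =>
      (G (P ∘ Sum.inl) r ∧ I (P ∘ Sum.inr) r) ∨ Q (P ∘ Sum.inr) r) (Sum.elim p q) r := by
  induction h generalizing q with
  | goal h => exact .goal (.inl ⟨h, hq⟩)
  | step f hf _ ih =>
    refine .of_forall fun r' hr => ?_
    obtain ⟨q', hq', h'⟩ := hI _ _ _ hq hr
    refine ⟨Sum.elim (f r') q', ?_, ?_⟩
    · rintro (i | k)
      · exact hf r' hr i
      · exact hq' k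
    · rcases h' with h' | h'
      · exact ih r' hr h'
      · exact .goal (.inr h')

/-- Reachability in exactly `n` steps. -/
def Steps (C : X → X → Prop) : ℕ → X → X → Prop
  | 0, u, v => u = v
  | n + 1, u, v => ∃ w, C u w ∧ Steps C n w v

theorem Steps.succ (hC : ∀ u, C u u) {n : ℕ} {u v : X} (h : Steps C n u v) :
    Steps C (n + 1) u v :=
  ⟨u, hC u, h⟩

theorem Steps.mono (hC : ∀ u, C u u) {n l : ℕ} (hl : n ≤ l) {u v : X} (h : Steps C n u v) :
    Steps C l u v := by
  induction hl with
  | refl => exact h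
  | step _ ih => exact ih.succ hC

theorem Steps.exists_of_reflTransGen {u v : X} (h : Relation.ReflTransGen C u v) :
    ∃ n, Steps C n u v := by
  induction h using Relation.ReflTransGen.head_induction_on with
  | refl => exact ⟨0, rfl⟩
  | head h _ ih =>
    obtain ⟨n, hn⟩ := ih
    exact ⟨n + 1, _, h, hn⟩

/-- The cops can walk to prescribed positions. -/
theorem Force.walk [Finite ι] (hC : ∀ u, C u u) {p f : ι → X} {r : X}
    (h : ∀ i, Relation.ReflTransGen C (p i) (f i)) : Force R C (fun q _ => q = f) p r := by
  have := Fintype.ofFinite ι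
  choose n hn using fun i => Steps.exists_of_reflTransGen (h i)
  obtain ⟨l, hl⟩ : ∃ l, ∀ i, Steps C l (p i) (f i) :=
    ⟨Finset.univ.sup n, fun i => (hn i).mono hC (Finset.le_sup (Finset.mem_univ i))⟩
  clear hn h n
  induction l generalizing p r with
  | zero => exact .goal (funext hl)
  | succ l ih =>
    choose g hg hg' using hl
    exact .step (fun _ => g) (fun _ _ => hg) fun _ _ => ih hg'

end Pursuit

/-! ## Folding one coordinate of a game along mirrors -/

namespace Pursuit

/-- `u` and `s` have the same image under folding `ℤ` at the multiples of `K`. -/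
def FoldEq (K u s : ℤ) : Prop :=
  ∃ z, u = s + 2 * K * z ∨ u = -s + 2 * K * z

theorem FoldEq.refl (K s : ℤ) : FoldEq K s s := ⟨0, .inl (by ring)⟩

theorem FoldEq.symm {K u s : ℤ} : FoldEq K u s → FoldEq K s u := by
  rintro ⟨z, h | h⟩
  · exact ⟨-z, .inl (by rw [h]; ring)⟩
  · exact ⟨z, .inr (by rw [h]; ring)⟩

theorem FoldEq.trans {K u s t : ℤ} : FoldEq K u s → FoldEq K s t → FoldEq K u t := by
  rintro ⟨z, h | h⟩ ⟨w, h' | h'⟩ <;> subst h h'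
  · exact ⟨z + w, .inl (by ring)⟩
  · exact ⟨z + w, .inr (by ring)⟩
  · exact ⟨z - w, .inr (by ring)⟩
  · exact ⟨z - w, .inl (by ring)⟩

theorem FoldEq.of_dvd_sub {K m u s : ℤ} (h : 2 * K * m ∣ u - s) : FoldEq K u s := by
  obtain ⟨z, hz⟩ := h
  exact ⟨m * z, .inl (by linear_combination hz)⟩

/-- A unit step can be folded back into a given strip between neighbouring mirrors. -/
theorem FoldEq.exists_mem_strip {K : ℤ} (hK : 0 < K) {j P p p' : ℤ} (h : FoldEq K P p)
    (hj : j * K ≤ P) (hj' : P ≤ (j + 1) * K) (hp : p' - p ≤ 1) (hp' : p - p' ≤ 1) :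
    ∃ u, FoldEq K u p' ∧ u - P ≤ 1 ∧ P - u ≤ 1 ∧ j * K ≤ u ∧ u ≤ (j + 1) * K := by
  obtain ⟨v, hv, h1, h2⟩ : ∃ v, FoldEq K v p' ∧ v - P ≤ 1 ∧ P - v ≤ 1 := by
    obtain ⟨z, h | h⟩ := h
    · exact ⟨p' + 2 * K * z, ⟨z, .inl rfl⟩, by linarith, by linarith⟩
    · exact ⟨-p' + 2 * K * z, ⟨z, .inr rfl⟩, by linarith, by linarith⟩
  have e : (j + 1) * K = j * K + K := by ring
  rw [e] at hj' ⊢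
  -- If the copied step crosses a mirror, its reflection in that mirror is still within distance 1
  -- of `P`.
  by_cases h3 : v < j * K
  · refine ⟨-v + 2 * K * j, FoldEq.trans ⟨j, .inr rfl⟩ hv, ?_⟩
    have : 2 * K * j = 2 * (j * K) := by ring
    rw [this]
    generalize j * K = a at *
    omega
  by_cases h4 : j * K + K < v
  · refine ⟨-v + 2 * K * (j + 1), FoldEq.trans ⟨j + 1, .inr rfl⟩ hv, ?_⟩
    have : 2 * K * (j + 1) = 2 * (j * K) + 2 * K := by ring
    rw [this]
    generalize j * K = a at *
    omega
  exact ⟨v, hv, h1, h2, not_lt.1 h3, not_lt.1 h4⟩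

/-- A strip between neighbouring mirrors is a fundamental domain of the folding group. -/
theorem FoldEq.eq_of_mem_strip {K : ℤ} {j u s : ℤ} (h : FoldEq K u s)
    (hu : j * K ≤ u) (hu' : u ≤ (j + 1) * K) (hs : j * K ≤ s) (hs' : s ≤ (j + 1) * K) :
    u = s := by
  rcases le_or_gt K 0 with hK | hK
  · nlinarith
  obtain ⟨z, h | h⟩ := h
  · have h1 : 2 * z < 2 := by by_contra! hc; nlinarith
    have h2 : -2 < 2 * z := by by_contra! hc; nlinarith
    obtain rfl : z = 0 := by omega
    linarith
  · rcases lt_trichotomy z j with h1 | h1 | h1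
    · nlinarith
    · subst h1
      nlinarith
    · rcases (show z = j + 1 ∨ j + 2 ≤ z by omega) with h2 | h2
      · subst h2
        nlinarith
      · nlinarith

theorem exists_foldEq_mem {K : ℤ} (hK : 0 < K) (t : ℤ) : ∃ u, FoldEq K u t ∧ 0 ≤ u ∧ u ≤ K := by
  have h1 := Int.emod_add_mul_ediv t (2 * K)
  have h2 := Int.emod_nonneg t (show 2 * K ≠ 0 by omega)
  have h3 := Int.emod_lt_of_pos t (show 0 < 2 * K by omega)
  have h4 : FoldEq K (t % (2 * K)) t := ⟨-(t / (2 * K)), .inl (by linear_combination h1)⟩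
  by_cases h5 : t % (2 * K) ≤ K
  · exact ⟨_, h4, h2, h5⟩
  · exact ⟨_, FoldEq.trans ⟨1, .inr rfl⟩ h4, by linarith, by linarith⟩

/-- A game with a coordinate `τ` whose mirrors lift moves, compatibly with a relation `E`. -/
structure IsMirrored {X : Type*} (M : X → X → Prop) (τ : X → ℤ) (E : X → X → Prop) (K : ℤ) :
    Prop where
  refl : ∀ p, M p p
  step_le : ∀ p q, M p q → τ q - τ p ≤ 1
  le_step : ∀ p q, M p q → τ p - τ q ≤ 1
  equiv : Equivalence E
  connected : ∀ p q, Relation.ReflTransGen M p q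
  surj : ∀ j, ∃ p, τ p = j
  lift : ∀ p p' q u', M p p' → E q p → FoldEq K (τ q) (τ p) → FoldEq K u' (τ p') →
    u' - τ q ≤ 1 → τ q - u' ≤ 1 → ∃ q', M q q' ∧ E q' p' ∧ τ q' = u'

variable {X : Type*} {M : X → X → Prop} {τ : X → ℤ} {E : X → X → Prop} {K : ℤ}

/-- The cop at `u` is the mirror image of the robber at `r` in the mirror `c`, up to the
period `2 * K * m`. -/
def Bar (τ : X → ℤ) (E : X → X → Prop) (K m c : ℤ) (u r : X) : Prop :=
  E u r ∧ 2 * K * m ∣ τ u + τ r - 2 * K * c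

/-- The cop at `u` is `a` double strips below the robber at `r`, up to the period `2 * K * m`. -/
def Par (τ : X → ℤ) (E : X → X → Prop) (K m a : ℤ) (u r : X) : Prop :=
  E u r ∧ 2 * K * m ∣ τ u - τ r + 2 * K * a

/-- Some cop coincides with the robber up to `E` and the period `2 * K * m` of `τ`. -/
def Caught {ι : Type*} (τ : X → ℤ) (E : X → X → Prop) (K m : ℤ) (p : ι → X) (r : X) : Prop :=
  ∃ i, E (p i) r ∧ 2 * K * m ∣ τ (p i) - τ r

/-- Some cop coincides with the robber up to `E` and folding of `τ`. -/
def FoldCaught {ι : Type*} (τ : X → ℤ) (E : X → X → Prop) (K : ℤ) (p : ι → X) (r : X) : Prop :=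
  ∃ i, E (p i) r ∧ FoldEq K (τ (p i)) (τ r)

/-! ### Undoing the folding with two extra cops -/

namespace IsMirrored

/-- The cop answers with the reflected step: `lift` supplies a move whose `τ`-increment is opposite
to the robber's. -/
theorem bar_move (h : IsMirrored M τ E K) {m c : ℤ} {u r r' : X} (hu : Bar τ E K m c u r)
    (hr : M r r') : ∃ u', M u u' ∧ Bar τ E K m c u' r' := by
  obtain ⟨hE, z, hz⟩ := hu
  have h1 := h.step_le _ _ hr
  have h2 := h.le_step _ _ hr
  obtain ⟨u', hM, hE', hu'⟩ := h.lift r r' u (τ u - (τ r' - τ r)) hr hE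
    ⟨m * z + c, .inr (by linear_combination hz)⟩ ⟨m * z + c, .inr (by linear_combination hz)⟩
    (by linarith) (by linarith)
  exact ⟨u', hM, hE', z, by rw [hu']; linear_combination hz⟩

theorem par_move (h : IsMirrored M τ E K) {m a : ℤ} {u r r' : X} (hu : Par τ E K m a u r)
    (hr : M r r') : ∃ u', M u u' ∧ Par τ E K m a u' r' := by
  obtain ⟨hE, z, hz⟩ := hu
  have h1 := h.step_le _ _ hr
  have h2 := h.le_step _ _ hr
  obtain ⟨u', hM, hE', hu'⟩ := h.lift r r' u (τ u + (τ r' - τ r)) hr hE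
    ⟨m * z - a, .inl (by linear_combination hz)⟩ ⟨m * z - a, .inl (by linear_combination hz)⟩
    (by linarith) (by linarith)
  exact ⟨u', hM, hE', z, by rw [hu']; linear_combination hz⟩

/-- A robber on a mirror is his own reflection, so a translate of him is also a reflection;
translating by `2 * K * a` shifts the mirror index by `a`. -/
theorem bar_of_par {m a l : ℤ} {u r : X} (hu : Par τ E K m a u r) (hl : τ r = l * K) :
    Bar τ E K m (l - a) u r := by
  obtain ⟨hE, z, hz⟩ := hu
  exact ⟨hE, z, by linear_combination hz + 2 * hl⟩

theorem caught_of_bar {ι : Type*} {m c : ℤ} {p : ι → X} {r : X} {i : ι}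
    (hu : Bar τ E K m c (p i) r) (hl : τ r = c * K) : Caught τ E K m p r := by
  obtain ⟨hE, z, hz⟩ := hu
  exact ⟨i, hE, z, by linear_combination hz - 2 * hl⟩

variable {ι : Type*} [Finite ι]

/-- From a common vertex the cops imagine a winning folded play `p` and perform its shadow `P`,
reflected back whenever it would leave the strip. Folding does not see the difference. The robber
himself need not be in the strip. -/
theorem force_strip (h : IsMirrored M τ E K) (hK : 0 < K)
    (h0 : ∀ (p : ι → X) r, Force M M (FoldCaught τ E K) p r) (j : ℤ) (p : ι → X) (r : X) :
    Force M M (fun (p : ι → X) r => ∃ i, E (p i) r ∧ FoldEq K (τ (p i)) (τ r) ∧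
      j * K ≤ τ (p i) ∧ τ (p i) ≤ (j + 1) * K) p r := by
  obtain ⟨q0, hq0⟩ := h.surj (j * K)
  refine (Force.walk (f := fun _ => q0) h.refl fun i => h.connected _ _).trans ?_
  rintro _ r rfl
  suffices H : ∀ (P p : ι → X) r, Force M M (FoldCaught τ E K) p r →
      (∀ i, E (P i) (p i) ∧ FoldEq K (τ (P i)) (τ (p i)) ∧
        j * K ≤ τ (P i) ∧ τ (P i) ≤ (j + 1) * K) → Force M M (fun (p : ι → X) r =>
        ∃ i, E (p i) r ∧ FoldEq K (τ (p i)) (τ r) ∧ j * K ≤ τ (p i) ∧ τ (p i) ≤ (j + 1) * K) P r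
    from H _ _ _ (h0 _ _) fun i => ⟨h.equiv.refl _, .refl _ _, hq0.ge, by rw [hq0]; linarith⟩
  clear hq0 q0 p r
  intro P p r hF
  induction hF generalizing P with
  | goal hg =>
    intro hP
    obtain ⟨i, hi, hi'⟩ := hg
    obtain ⟨h1, h2, h3⟩ := hP i
    exact .goal ⟨i, h.equiv.trans h1 hi, h2.trans hi', h3⟩
  | @step p r f hf _ ih =>
    intro hP
    refine .of_forall fun r' hr => ?_
    have : ∀ i, ∃ u, M (P i) u ∧ E u (f r' i) ∧ FoldEq K (τ u) (τ (f r' i)) ∧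
        j * K ≤ τ u ∧ τ u ≤ (j + 1) * K := by
      intro i
      obtain ⟨h1, h2, h3, h4⟩ := hP i
      have hm := hf r' hr i
      obtain ⟨u, hu, hu1, hu2, hu3⟩ := h2.exists_mem_strip hK h3 h4 (h.step_le _ _ hm)
        (h.le_step _ _ hm)
      obtain ⟨q', hq, hq', rfl⟩ := h.lift _ _ _ u hm h1 h2 hu hu1 hu2
      exact ⟨q', hq, hq', hu, hu3⟩
    choose P' hP1 hP2 using this
    exact ⟨P', hP1, ih r' hr P' hP2⟩

theorem force_strip_side (h : IsMirrored M τ E K) (hK : 0 < K)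
    (h0 : ∀ (p : ι → X) r, Force M M (FoldCaught τ E K) p r) {κ : Type*}
    (I Q : (κ → X) → X → Prop)
    (hI : ∀ q r r', I q r → M r r' →
      ∃ q' : κ → X, (∀ k, M (q k) (q' k)) ∧ (I q' r' ∨ Q q' r'))
    (j : ℤ) (p : ι ⊕ κ → X) (r : X) (hp : I (p ∘ Sum.inr) r) :
    Force M M (fun (p : ι ⊕ κ → X) r => ((∃ i, E (p (.inl i)) r ∧
      FoldEq K (τ (p (.inl i))) (τ r) ∧ j * K ≤ τ (p (.inl i)) ∧ τ (p (.inl i)) ≤ (j + 1) * K) ∧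
      I (p ∘ Sum.inr) r) ∨ Q (p ∘ Sum.inr) r) p r := by
  have := Force.side I Q hI (h.force_strip hK h0 j (p ∘ Sum.inl) r) hp
  rwa [Sum.elim_comp_inl_inr] at this

/-- A parallel cop becomes a mirror image, or the robber is caught inside a strip. -/
theorem force_of_par (h : IsMirrored M τ E K) (hK : 0 < K)
    (h0 : ∀ (p : ι → X) r, Force M M (FoldCaught τ E K) p r) (m a i : ℤ) (J : X → X → Prop)
    (hJ : ∀ u r r', J u r → M r r' → ∃ u', M u u' ∧ J u' r')
    (p : ι ⊕ Bool → X) (r : X) (hp : J (p (.inr true)) r)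
    (hw : Par τ E K m a (p (.inr false)) r) (hr : i * K ≤ τ r) (hr' : τ r ≤ (i + 1) * K) :
    Force M M (fun (p : ι ⊕ Bool → X) r => Caught τ E K m p r ∨
      (J (p (.inr true)) r ∧ Par τ E K m a (p (.inr false)) r ∧
        (τ r = i * K ∨ τ r = (i + 1) * K))) p r := by
  by_cases h1 : τ r = i * K ∨ τ r = (i + 1) * K
  · exact .goal (.inr ⟨hp, hw, h1⟩)
  push Not at h1
  -- The other cops play in the robber's own strip: either he touches a bounding mirror, or fold
  -- equality inside one strip is equality and he is caught.
  refine (h.force_strip_side hK h0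
    (fun q r => J (q true) r ∧ Par τ E K m a (q false) r ∧ i * K < τ r ∧ τ r < (i + 1) * K)
    (fun q r => J (q true) r ∧ Par τ E K m a (q false) r ∧ (τ r = i * K ∨ τ r = (i + 1) * K))
    ?_ i p r ⟨hp, hw, lt_of_le_of_ne hr h1.1.symm, lt_of_le_of_ne hr' h1.2⟩).mono ?_
  · rintro q r r' ⟨h1, h2, h3, h4⟩ hM
    obtain ⟨u, hu, hu'⟩ := hJ _ _ _ h1 hM
    obtain ⟨v, hv, hv'⟩ := h.par_move h2 hM
    have h5 := h.step_le _ _ hM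
    have h6 := h.le_step _ _ hM
    refine ⟨fun b => if b then u else v, by simp [hu, hv], ?_⟩
    simp only [if_true, Bool.false_eq_true, if_false, hu', hv', true_and]
    omega
  · rintro p r (⟨⟨l, h1, h2, h3, h4⟩, -, -, h5, h6⟩ | h1)
    · have := h2.eq_of_mem_strip h3 h4 h5.le h6.le
      exact .inl ⟨.inl l, h1, by rw [this]; simp⟩
    · exact .inr h1

/-- For `b = true` a single cop carries both walls; his one answer preserves both because they
differ by a multiple of the period. -/
theorem bars_move (h : IsMirrored M τ E K) {m c c' : ℤ} {b : Bool} {q : Bool → X} {r r' : X}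
    (h1 : Bar τ E K m c (q true) r) (h2 : Bar τ E K m c' (q b) r) (hr : M r r') :
    ∃ q' : Bool → X, (∀ k, M (q k) (q' k)) ∧ Bar τ E K m c (q' true) r' ∧
      Bar τ E K m c' (q' b) r' := by
  obtain ⟨u, hu, hu'⟩ := h.bar_move h1 hr
  cases b with
  | true =>
    refine ⟨fun k => if k then u else q k, ?_, hu', hu'.1, ?_⟩
    · rintro (_ | _)
      · simpa using h.refl _
      · exact hu
    · have := dvd_sub (h2.2) h1.2
      simpa using dvd_add hu'.2 this
  | false =>
    obtain ⟨v, hv, hv'⟩ := h.bar_move h2 hr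
    refine ⟨fun k => if k then u else v, ?_, hu', hv'⟩
    rintro (_ | _)
    · exact hv
    · exact hu

theorem Caught.of_comp {ι : Type*} {m : ℤ} (e : Equiv.Perm ι) (p : ι → X) (r : X)
    (h : Caught τ E K m (p ∘ e) r) : Caught τ E K m p r :=
  let ⟨i, hi⟩ := h
  ⟨e i, hi⟩

/-- Two barriers enclosing the robber can be moved together until he is caught. -/
theorem force_of_bars (h : IsMirrored M τ E K) (hK : 0 < K)
    (h0 : ∀ (p : ι → X) r, Force M M (FoldCaught τ E K) p r) (m : ℤ) (d : ℕ) :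
    ∀ (c c' : ℤ), c - c' ≤ d → ∀ (p : ι ⊕ Bool → X) (r : X) (b : Bool),
      Bar τ E K m c (p (.inr true)) r → Bar τ E K m c' (p (.inr b)) r →
      c' * K ≤ τ r → τ r ≤ c * K → Force M M (Caught τ E K m) p r := by
  classical
  induction d with
  | zero =>
    intro c c' hd p r b h1 h2 h3 h4
    refine .goal (caught_of_bar h1 ?_)
    simp only [Nat.cast_zero] at hd
    nlinarith
  | succ d ih =>
    intro c c' hd p r b h1 h2 h3 h4
    by_cases h5 : τ r = c * K
    · exact .goal (caught_of_bar h1 h5)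
    by_cases h6 : τ r = c' * K
    · exact .goal (caught_of_bar h2 h6)
    -- The play takes place in the lowest enclosed strip, so that any wall it produces lies strictly
    -- between the old ones and below the robber.
    refine (h.force_strip_side hK h0
      (fun q r => Bar τ E K m c (q true) r ∧ Bar τ E K m c' (q b) r ∧ c' * K < τ r ∧ τ r < c * K)
      (fun q r => (Bar τ E K m c (q true) r ∧ τ r = c * K) ∨
        (Bar τ E K m c' (q b) r ∧ τ r = c' * K))
      ?_ c' p r ⟨h1, h2, lt_of_le_of_ne h3 (Ne.symm h6), lt_of_le_of_ne h4 h5⟩).trans ?_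
    · rintro q r r' ⟨h1, h2, h3, h4⟩ hM
      obtain ⟨q', hq, hq1, hq2⟩ := h.bars_move h1 h2 hM
      have h5 := h.step_le _ _ hM
      have h6 := h.le_step _ _ hM
      refine ⟨q', hq, ?_⟩
      simp only [hq1, hq2, true_and]
      omega
    clear h1 h2 h3 h4 h5 h6 p r
    rintro p r (⟨⟨i, hE, hF, h5, h6⟩, h1, h2, h3, h4⟩ | ⟨h1, h2⟩ | ⟨h1, h2⟩)
    rotate_left
    · exact .goal (caught_of_bar h1 h2)
    · exact .goal (caught_of_bar h1 h2)
    simp only [Function.comp_apply] at h1 h2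
    set w := p (.inl i) with hw
    have key : ∀ (c'' : ℤ) (p : ι ⊕ Bool → X) (r : X), c' < c'' → c'' < c →
        Bar τ E K m c (p (.inr true)) r → Bar τ E K m c'' (p (.inr false)) r → c'' * K ≤ τ r →
        τ r ≤ c * K → Force M M (Caught τ E K m) p r := by
      intro c'' p r h1 h2 h3 h4 h5 h6
      refine ih c c'' ?_ p r false h3 h4 h5 h6
      push_cast at hd
      omega
    -- The successful cop `w` takes the label `false`; the previous holder, a lower wall or a spare
    -- cop, is released. The upper wall stays with `true`.
    refine Force.reindex (Equiv.swap (.inl i) (.inr false)) (Caught.of_comp _) ?_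
    have e1 : (p ∘ Equiv.swap (.inl i) (.inr false)) (.inr false) = w := by simp [hw]
    have e2 : (p ∘ Equiv.swap (.inl i) (.inr false)) (.inr true) = p (.inr true) := by
      simp only [Function.comp_apply]
      rw [Equiv.swap_apply_of_ne_of_ne] <;> simp
    generalize p ∘ Equiv.swap (.inl i) (.inr false) = P at e1 e2
    obtain ⟨z, hz | hz⟩ := hF
    · -- the new cop is parallel to the robber
      obtain ⟨a, rfl⟩ : ∃ a, z = -a := ⟨-z, by simp⟩
      have ha0 : 0 ≤ a := by
        by_contra! hc
        nlinarith
      rcases eq_or_lt_of_le ha0 with rfl | ha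
      · exact .goal ⟨.inr false, e1 ▸ hE, by rw [e1, hz]; simp⟩
      have hpar : Par τ E K m a (P (.inr false)) r :=
        ⟨e1 ▸ hE, by rw [e1, hz]; simp⟩
      -- Since `w` is in strip `c'` and `a` double strips below the robber, he is in strip `c' + 2 *
      -- a`. That strip confines him, so the lower wall is dispensable meanwhile.
      refine (h.force_of_par hK h0 m a (c' + 2 * a)
        (fun u r => Bar τ E K m c u r) (fun u r r' hu hr => h.bar_move hu hr)
        P r (e2 ▸ h1) hpar (by linarith) (by linarith)).trans ?_
      have hac : c' + 2 * a < c := by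
        by_contra! hc
        nlinarith
      rintro p r (hp | ⟨hb, hp, hl⟩)
      · exact .goal hp
      obtain ⟨l, hl, hl1, hl2⟩ : ∃ l, τ r = l * K ∧ c' + 2 * a ≤ l ∧ l ≤ c' + 2 * a + 1 := by
        rcases hl with hl | hl
        · exact ⟨_, hl, by omega, by omega⟩
        · exact ⟨_, hl, by omega, by omega⟩
      refine key (l - a) p r (by omega) (by omega) hb (bar_of_par hp hl) ?_ ?_
      · rw [hl]
        nlinarith
      · rw [hl]
        nlinarith
    · -- the new cop is a mirror image of the robber
      have hz1 : c' < z := by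
        by_contra! hc
        nlinarith
      have hz2 : z < c := by
        by_contra! hc
        nlinarith
      refine key z P r hz1 hz2 (e2 ▸ h1) ⟨e1 ▸ hE, by rw [e1, hz]; simp⟩ ?_ h4.le
      nlinarith

/-- With two additional cops, the folding of the coordinate `τ` can be undone. -/
theorem force_caught (h : IsMirrored M τ E K) (hK : 0 < K)
    (h0 : ∀ (p : ι → X) r, Force M M (FoldCaught τ E K) p r) {m : ℤ} (hm : 0 < m)
    (p : ι ⊕ Bool → X) (r : X) : Force M M (Caught τ E K m) p r := by
  classical
  have key : ∀ (c : ℤ) (p : ι ⊕ Bool → X) (r : X), Bar τ E K m c (p (.inr true)) r →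
      Force M M (Caught τ E K m) p r := by
    intro c p r hb
    -- By periodicity one cop is a wall at every `c + m * z`, hence on both sides of the robber.
    have h1 : ∀ z, Bar τ E K m (c + m * z) (p (.inr true)) r := by
      intro z
      obtain ⟨y, hy⟩ := hb.2
      exact ⟨hb.1, y - z, by linear_combination hy⟩
    obtain ⟨n, hn⟩ : ∃ n : ℕ, |τ r| + |c| ≤ n := ⟨_, (Int.self_le_toNat _)⟩
    have a1 := neg_abs_le (τ r)
    have a2 := le_abs_self (τ r)
    have a3 := neg_abs_le c
    have a4 := le_abs_self c
    have a5 : (n : ℤ) ≤ m * n := by nlinarith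
    have a6 : (0 : ℤ) ≤ n := by positivity
    have a7 := abs_nonneg (τ r)
    refine h.force_of_bars hK h0 m _ (c + m * n) (c + m * (-n)) (Int.self_le_toNat _) p r true
      (h1 _) (h1 _) ?_ ?_
    · by_cases h0 : c + m * (-n) ≤ -|τ r|
      · nlinarith
      · nlinarith
    · by_cases h0 : |τ r| ≤ c + m * n
      · nlinarith
      · nlinarith
  refine (Force.mono ?_ fun p r (hp : FoldCaught τ E K (p ∘ Sum.inl) r ∧ True ∨ False) => ?_ :
    Force M M (fun p r => FoldCaught τ E K (p ∘ Sum.inl) r) p r).trans ?_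
  · have := Force.side (fun _ _ => True) (fun _ _ => False)
      (fun q _ _ _ _ => ⟨q, fun _ => h.refl _, .inl trivial⟩) (h0 (p ∘ Sum.inl) r)
      (q := p ∘ Sum.inr) trivial
    rwa [Sum.elim_comp_inl_inr] at this
  · simpa using hp
  rintro p r ⟨i, hE, z, hz | hz⟩
  · refine Force.reindex (Equiv.swap (.inl i) (.inr false)) (Caught.of_comp _) ?_
    have e1 : (p ∘ Equiv.swap (.inl i) (.inr false)) (.inr false) = p (.inl i) := by simp
    generalize p ∘ Equiv.swap (.inl i) (.inr false) = P at e1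
    have e2 := Int.emod_add_mul_ediv (τ r) K
    have e3 := Int.emod_nonneg (τ r) hK.ne'
    have e4 := Int.emod_lt_of_pos (τ r) hK
    have hpar : Par τ E K m (-z) (P (.inr false)) r := by
      refine ⟨e1 ▸ hE, ?_⟩
      simp only [Function.comp_apply] at hz
      rw [e1, hz]
      simp
    refine (h.force_of_par hK h0 m (-z) (τ r / K) (fun _ _ => True)
      (fun u _ _ _ _ => ⟨u, h.refl _, trivial⟩) P r trivial hpar (by linarith)
      (by linarith)).trans ?_
    rintro p r (hp | ⟨-, hp, hl⟩)
    · exact .goal hp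
    obtain ⟨l, hl⟩ : ∃ l, τ r = l * K := by
      rcases hl with hl | hl <;> exact ⟨_, hl⟩
    refine Force.reindex (Equiv.swap (.inr false) (.inr true)) (Caught.of_comp _) ?_
    exact key (l - -z) _ r (by simpa using bar_of_par hp hl)
  · refine Force.reindex (Equiv.swap (.inl i) (.inr true)) (Caught.of_comp _) ?_
    refine key z _ r ⟨by simpa using hE, ?_⟩
    simp only [Function.comp_apply] at hz
    simp [hz]

end IsMirrored

end Pursuit

/-! ## The regularly oriented infinite grid -/

namespace Pursuit

/-- Direction of the line with index `z`: positive on `[0, k)`, then alternating. -/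
def dir (k : ℕ) (z : ℤ) : ℤ := if Even (z / (k : ℤ)) then 1 else -1

theorem dir_eq (k : ℕ) (z : ℤ) : dir k z = 1 ∨ dir k z = -1 := by
  unfold dir
  split <;> simp

theorem dir_add {k : ℕ} (hk : 0 < k) (z : ℤ) : dir k (z + k) = -dir k z := by
  have : (z + k) / (k : ℤ) = z / k + 1 := by
    rw [Int.add_ediv_of_dvd_right dvd_rfl, Int.ediv_self (by omega)]
  simp only [dir, this, Int.even_add_one]
  split_ifs <;> simp_all

theorem dir_sub {k : ℕ} (hk : 0 < k) (z : ℤ) : dir k (z - k) = -dir k z := by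
  rw [eq_neg_iff_add_eq_zero, add_comm]
  have := dir_add hk (z - k)
  rw [sub_add_cancel] at this
  omega

theorem dir_add_mul {k : ℕ} (hk : 0 < k) (z w : ℤ) : dir k (z + 2 * k * w) = dir k z := by
  have : (z + 2 * k * w) / (k : ℤ) = z / k + 2 * w := by
    rw [show z + 2 * (k : ℤ) * w = z + k * (2 * w) by ring, Int.add_mul_ediv_left _ _ (by omega)]
  simp [dir, this, Int.even_add]

theorem dir_neg {k : ℕ} (hk : 0 < k) (z : ℤ) : dir k (-1 - z) = -dir k z := by
  have h1 := Int.emod_add_mul_ediv z k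
  have h2 := Int.emod_nonneg z (show (k : ℤ) ≠ 0 by omega)
  have h3 := Int.emod_lt_of_pos z (show 0 < (k : ℤ) by omega)
  have : (-1 - z) / (k : ℤ) = -(z / k) - 1 := by
    refine ((Int.ediv_emod_unique (r := k - 1 - z % k) (by omega)).2
      ⟨by linear_combination -h1, by omega, by omega⟩).1
  unfold dir
  rw [this]
  have : Even (-(z / (k : ℤ)) - 1) ↔ ¬ Even (z / (k : ℤ)) := by
    rw [Int.even_sub, even_neg]
    simp
  split_ifs <;> simp_all

theorem dir_of_lt {k : ℕ} {z : ℤ} (h0 : 0 ≤ z) (hz : z < k) : dir k z = 1 := by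
  simp [dir, Int.ediv_eq_zero_of_lt h0 hz]

theorem dir_reflect {k : ℕ} (hk : 0 < k) (z : ℤ) : dir k (k - 1 - z) = dir k z := by
  rw [show (k : ℤ) - 1 - z = -1 - (z - k) by ring, dir_neg hk, dir_sub hk, neg_neg]

theorem exists_dir_eq {k : ℕ} (hk : 0 < k) {ε η : ℤ} (hε : ε = 1 ∨ ε = -1)
    (hη : η = 1 ∨ η = -1) (a b : ℤ) :
    ∃ z, dir k z = ε ∧ 0 ≤ η * (z - a) ∧ 0 ≤ η * (z - b) := by
  obtain ⟨z, hz, hz0, hz1⟩ : ∃ z, dir k z = ε ∧ 0 ≤ z ∧ z ≤ k := by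
    rcases hε with rfl | rfl
    · exact ⟨0, dir_of_lt le_rfl (by omega), le_rfl, by omega⟩
    · exact ⟨k, by simpa [dir_of_lt (k := k) le_rfl (by omega)] using dir_add hk 0, by omega,
        le_rfl⟩
  have a1 := neg_abs_le a
  have a2 := le_abs_self a
  have b1 := neg_abs_le b
  have b2 := le_abs_self b
  have c0 : (1 : ℤ) ≤ k := by omega
  have c1 : |a| + |b| + 1 ≤ k * (|a| + |b| + 1) := by nlinarith [abs_nonneg a, abs_nonneg b]
  have c2 : (k : ℤ) ≤ k * (|a| + |b| + 1) := by nlinarith [abs_nonneg a, abs_nonneg b]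
  refine ⟨z + 2 * k * (η * (|a| + |b| + 1)), by rw [dir_add_mul hk, hz], ?_⟩
  have e : 2 * k * (η * (|a| + |b| + 1)) = η * (2 * (k * (|a| + |b| + 1))) := by ring
  rw [e]
  generalize (k : ℤ) * (|a| + |b| + 1) = s at *
  have := abs_nonneg a
  have := abs_nonneg b
  rcases hη with rfl | rfl <;> constructor <;> omega

/-- A move in the infinite grid. -/
def GridMove (k : ℕ) (p q : ℤ × ℤ) : Prop :=
  q = p ∨ q = (p.1 + dir k p.2, p.2) ∨ q = (p.1, p.2 + dir k p.1)

/-- The first diagonal coordinate. -/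
def sigma (p : ℤ × ℤ) : ℤ := p.2 - p.1

/-- The second diagonal coordinate. -/
def tau (p : ℤ × ℤ) : ℤ := p.1 + p.2 + 1

theorem GridMove.translate {k : ℕ} (hk : 0 < k) (a b : ℤ) {x y x' y' : ℤ}
    (h : GridMove k (x, y) (x', y')) :
    GridMove k (x + 2 * k * a, y + 2 * k * b) (x' + 2 * k * a, y' + 2 * k * b) := by
  simp only [GridMove, Prod.mk.injEq, dir_add_mul hk] at *
  omega

theorem GridMove.swap {k : ℕ} {x y x' y' : ℤ} (h : GridMove k (x, y) (x', y')) :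
    GridMove k (y, x) (y', x') := by
  simp only [GridMove, Prod.mk.injEq] at *
  omega

theorem GridMove.antiswap {k : ℕ} (hk : 0 < k) {x y x' y' : ℤ}
    (h : GridMove k (x, y) (x', y')) : GridMove k (-1 - y, -1 - x) (-1 - y', -1 - x') := by
  simp only [GridMove, Prod.mk.injEq, dir_neg hk] at *
  omega

theorem GridMove.sigma_le {k : ℕ} {p q : ℤ × ℤ} (h : GridMove k p q) :
    sigma q - sigma p ≤ 1 ∧ sigma p - sigma q ≤ 1 := by
  have h1 := dir_eq k p.1
  have h2 := dir_eq k p.2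
  simp only [GridMove, Prod.ext_iff, sigma] at *
  omega

theorem GridMove.tau_le {k : ℕ} {p q : ℤ × ℤ} (h : GridMove k p q) :
    tau q - tau p ≤ 1 ∧ tau p - tau q ≤ 1 := by
  have h1 := dir_eq k p.1
  have h2 := dir_eq k p.2
  simp only [GridMove, Prod.ext_iff, tau] at *
  omega

theorem eq_of_mul_sub_le {K z z' : ℤ} (hK : 2 ≤ K) (h1 : K * z' - K * z ≤ 1)
    (h2 : K * z - K * z' ≤ 1) : z' = z := by
  rcases lt_trichotomy z z' with h | h | h
  · nlinarith
  · exact h.symm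
  · nlinarith

/-- Two unit steps that agree after folding agree under a single reflection or translation. -/
theorem FoldEq.exists_common {K u u' s s' : ℤ} (hK : 2 ≤ K) (h : FoldEq K u s)
    (h' : FoldEq K u' s') (hu : u' - u ≤ 1) (hu' : u - u' ≤ 1) (hs : s' - s ≤ 1)
    (hs' : s - s' ≤ 1) :
    ∃ z, (u = s + 2 * K * z ∧ u' = s' + 2 * K * z) ∨
      (u = -s + 2 * K * z ∧ u' = -s' + 2 * K * z) := by
  have m : ∀ z, 2 * K * z = 2 * (K * z) := fun z => by ring
  obtain ⟨z, h | h⟩ := h <;> obtain ⟨w, h' | h'⟩ := h' <;> simp only [m] at *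
  · have : w = z := eq_of_mul_sub_le hK (by omega) (by omega)
    exact ⟨z, .inl ⟨h, by rw [h', this]⟩⟩
  -- The two descriptions can differ only if `s` or `s'` lies on a mirror, and there reflection and
  -- translation agree.
  · by_cases e : s = K * w - K * z
    · exact ⟨w, .inr ⟨by omega, h'⟩⟩
    · exact ⟨z, .inl ⟨h, by omega⟩⟩
  · by_cases e : s = K * z - K * w
    · exact ⟨w, .inl ⟨by omega, h'⟩⟩
    · exact ⟨z, .inr ⟨h, by omega⟩⟩
  · have : w = z := eq_of_mul_sub_le hK (by omega) (by omega)
    exact ⟨z, .inr ⟨h, by rw [h', this]⟩⟩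

/-- Moves can be lifted along folding in both diagonal coordinates. -/
theorem GridMove.lift {k : ℕ} (hk : 0 < k) {p p' q : ℤ × ℤ} {u w : ℤ} (h : GridMove k p p')
    (h1 : FoldEq (2 * k) (sigma q) (sigma p)) (h2 : FoldEq (2 * k) (tau q) (tau p))
    (h3 : FoldEq (2 * k) u (sigma p')) (h4 : FoldEq (2 * k) w (tau p'))
    (hu : u - sigma q ≤ 1) (hu' : sigma q - u ≤ 1) (hw : w - tau q ≤ 1) (hw' : tau q - w ≤ 1) :
    ∃ q', GridMove k q q' ∧ sigma q' = u ∧ tau q' = w := by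
  obtain ⟨z, hz⟩ := h1.exists_common (by omega) h3 hu hu' h.sigma_le.1 h.sigma_le.2
  obtain ⟨v, hv⟩ := h2.exists_common (by omega) h4 hw hw' h.tau_le.1 h.tau_le.2
  obtain ⟨x, y⟩ := p
  obtain ⟨x', y'⟩ := p'
  obtain ⟨X, Y⟩ := q
  simp only [sigma, tau] at *
  have m : ∀ z, 2 * (2 * (k : ℤ)) * z = 4 * (k * z) := fun z => by ring
  have m2 : ∀ z, 2 * (k : ℤ) * z = 2 * (k * z) := fun z => by ring
  have m3 : (k : ℤ) * (v - z) = k * v - k * z := by ring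
  have m4 : (k : ℤ) * (v + z) = k * v + k * z := by ring
  simp only [m] at hz hv
  have of_eq : ∀ a b c d, GridMove k (a, b) (c, d) → a = X → b = Y → d - c = u →
      c + d + 1 = w → ∃ q' : ℤ × ℤ, GridMove k (X, Y) q' ∧ q'.2 - q'.1 = u ∧
        q'.1 + q'.2 + 1 = w := by
    rintro a b c d h rfl rfl h1 h2
    exact ⟨_, h, h1, h2⟩
  -- `swap` negates `sigma` and `antiswap` negates `tau`; translating by `2k(v - z)` and `2k(v + z)`
  -- then adds `4kz` to `sigma` and `4kv` to `tau`.
  rcases hz with ⟨hz, hz'⟩ | ⟨hz, hz'⟩ <;> rcases hv with ⟨hv, hv'⟩ | ⟨hv, hv'⟩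
  · have := h.translate hk (v - z) (v + z)
    simp only [m2, m3, m4] at this
    exact of_eq _ _ _ _ this (by omega) (by omega) (by omega) (by omega)
  · have := (h.antiswap hk).translate hk (v - z) (v + z)
    simp only [m2, m3, m4] at this
    exact of_eq _ _ _ _ this (by omega) (by omega) (by omega) (by omega)
  · have := h.swap.translate hk (v - z) (v + z)
    simp only [m2, m3, m4] at this
    exact of_eq _ _ _ _ this (by omega) (by omega) (by omega) (by omega)
  · have := (h.swap.antiswap hk).translate hk (v - z) (v + z)
    simp only [m2, m3, m4] at this
    exact of_eq _ _ _ _ this (by omega) (by omega) (by omega) (by omega)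

open Relation in
theorem GridMove.reflTransGen_row {k : ℕ} {x x' y : ℤ} (h : 0 ≤ dir k y * (x' - x)) :
    ReflTransGen (GridMove k) (x, y) (x', y) := by
  obtain ⟨n, hn⟩ := Int.eq_ofNat_of_zero_le h
  have hx : x' = x + dir k y * n := by
    rcases dir_eq k y with e | e <;> rw [e] at hn ⊢ <;> linarith
  subst hx
  clear hn h
  induction n with
  | zero => simpa using ReflTransGen.refl
  | succ n ih => exact ih.tail (.inr (.inl (by simp; ring)))

open Relation in
theorem GridMove.reflTransGen_col {k : ℕ} {x y y' : ℤ} (h : 0 ≤ dir k x * (y' - y)) :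
    ReflTransGen (GridMove k) (x, y) (x, y') := by
  obtain ⟨n, hn⟩ := Int.eq_ofNat_of_zero_le h
  have hx : y' = y + dir k x * n := by
    rcases dir_eq k x with e | e <;> rw [e] at hn ⊢ <;> linarith
  subst hx
  clear hn h
  induction n with
  | zero => simpa using ReflTransGen.refl
  | succ n ih => exact ih.tail (.inr (.inr (by simp; ring)))

/-- Four legs: along row `y` past both columns to a column running against column `x'`, along it
past both rows to a row running against row `y`, back to column `x'`, and along that to the target.
-/
theorem GridMove.connected {k : ℕ} (hk : 0 < k) (p q : ℤ × ℤ) :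
    Relation.ReflTransGen (GridMove k) p q := by
  obtain ⟨x, y⟩ := p
  obtain ⟨x', y'⟩ := q
  have hy := dir_eq k y
  have hx' := dir_eq k x'
  obtain ⟨x1, h1, h2, h3⟩ := exists_dir_eq hk (ε := -dir k x') (by omega) hy x x'
  obtain ⟨y1, h4, h5, h6⟩ := exists_dir_eq hk (ε := -dir k y) (by omega)
    (η := -dir k x') (by omega) y y'
  refine (reflTransGen_row (x' := x1) h2).trans ((reflTransGen_col (y' := y1) ?_).trans
    ((reflTransGen_row (x' := x') ?_).trans (reflTransGen_col ?_)))
  · rwa [h1]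
  · rw [h4]; linarith
  · linarith

theorem isMirrored_tau {k : ℕ} (hk : 0 < k) :
    IsMirrored (GridMove k) tau (fun p q => FoldEq (2 * k) (sigma p) (sigma q)) (2 * k) where
  refl _ := .inl rfl
  step_le _ _ h := h.tau_le.1
  le_step _ _ h := h.tau_le.2
  equiv := ⟨fun _ => .refl _ _, FoldEq.symm, FoldEq.trans⟩
  connected := GridMove.connected hk
  surj j := ⟨(j - 1, 0), by simp [tau]⟩
  lift p p' q u' hM hE hF hu h1 h2 := by
    obtain ⟨s, hs, hs1, hs2⟩ : ∃ v, FoldEq (2 * k) v (sigma p') ∧ v - sigma q ≤ 1 ∧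
        sigma q - v ≤ 1 := by
      have := hM.sigma_le
      obtain ⟨z, h | h⟩ := hE
      · exact ⟨_, ⟨z, .inl rfl⟩, by linarith, by linarith⟩
      · exact ⟨_, ⟨z, .inr rfl⟩, by linarith, by linarith⟩
    obtain ⟨q', h3, h4, h5⟩ := hM.lift hk hE hF hs hu hs1 hs2 h1 h2
    exact ⟨q', h3, h4 ▸ hs, h5⟩

/-- With `tau` already unfolded, equality modulo its period replaces fold equality, and
`tau`-increments are copied exactly. -/
theorem isMirrored_sigma {k : ℕ} (hk : 0 < k) (m : ℤ) :
    IsMirrored (GridMove k) sigma (fun p q => 2 * (2 * k) * m ∣ tau p - tau q) (2 * k) where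
  refl _ := .inl rfl
  step_le _ _ h := h.sigma_le.1
  le_step _ _ h := h.sigma_le.2
  equiv := ⟨fun _ => by simp, fun h => by rw [← neg_sub]; exact h.neg_right,
    fun h h' => by simpa using dvd_add h h'⟩
  connected := GridMove.connected hk
  surj j := ⟨(0, j), by simp [sigma]⟩
  lift p p' q u' hM hE hF hu h1 h2 := by
    have h6 := hM.tau_le
    have hE' : 2 * (2 * (k : ℤ)) * m ∣ (tau q + (tau p' - tau p)) - tau p' := by
      convert hE using 1
      ring
    obtain ⟨q', h3, h4, h5⟩ := hM.lift hk hF (.of_dvd_sub hE) hu (.of_dvd_sub hE') h1 h2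
      (by linarith) (by linarith)
    exact ⟨q', h3, h5 ▸ hE', h4⟩

end Pursuit

/-! ## The game inside a diamond -/

namespace Pursuit

/-- The diamond around the vortex `(-1/2, k - 1/2)`. -/
def Diamond (k : ℕ) (p : ℤ × ℤ) : Prop :=
  0 ≤ sigma p ∧ sigma p ≤ 2 * k ∧ 0 ≤ tau p ∧ tau p ≤ 2 * k

/-- A move of a robber who is confined to the diamond. -/
def DiamondMove (k : ℕ) (p q : ℤ × ℤ) : Prop :=
  GridMove k p q ∧ Diamond k p ∧ Diamond k q

/-- The rotation of the grid about the vortex `(-1/2, k - 1/2)`. -/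
def rot (k : ℕ) : (ℤ × ℤ) ≃ (ℤ × ℤ) where
  toFun p := (k - 1 - p.2, p.1 + k)
  invFun p := (p.2 - k, k - 1 - p.1)
  left_inv p := by simp
  right_inv p := by simp

theorem GridMove.rot {k : ℕ} (hk : 0 < k) {p q : ℤ × ℤ} (h : GridMove k p q) :
    GridMove k (rot k p) (rot k q) := by
  simp only [GridMove, Pursuit.rot, Equiv.coe_fn_mk, Prod.ext_iff, dir_reflect hk,
    dir_add hk] at *
  omega

theorem GridMove.rot_symm {k : ℕ} (hk : 0 < k) {p q : ℤ × ℤ} (h : GridMove k p q) :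
    GridMove k ((Pursuit.rot k).symm p) ((Pursuit.rot k).symm q) := by
  simp only [GridMove, Pursuit.rot, Equiv.coe_fn_symm_mk, Prod.ext_iff, dir_reflect hk,
    dir_sub hk] at *
  omega

theorem Diamond.rot_symm {k : ℕ} {p : ℤ × ℤ} (h : Diamond k p) :
    Diamond k ((rot k).symm p) := by
  simp only [Diamond, rot, Equiv.coe_fn_symm_mk, sigma, tau] at *
  omega

variable {ι : Type*} {k : ℕ}

/-- Quarter turns reduce all four cells of the diamond to the cell `0 ≤ x ≤ y < k`. -/
theorem force_of_rot_symm (hk : 0 < k) {p : ι → ℤ × ℤ} {r : ℤ × ℤ}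
    (h : Force (DiamondMove k) (GridMove k) (fun p r => ∃ i, p i = r) ((rot k).symm ∘ p)
      ((rot k).symm r)) :
    Force (DiamondMove k) (GridMove k) (fun p r => ∃ i, p i = r) p r := by
  refine Force.transport (rot k).symm (fun u v huv => ⟨huv.1.rot_symm hk, huv.2.1.rot_symm,
    huv.2.2.rot_symm⟩) (fun u v huv => by simpa using huv.rot hk) ?_ h
  rintro p r ⟨i, hi⟩
  exact ⟨i, (rot k).symm.injective hi⟩

theorem diamondMove_cases {x y : ℤ} {r' : ℤ × ℤ} (hx : 0 ≤ x) (hxy : x ≤ y) (hy : y < k)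
    (h : DiamondMove k (x, y) r') :
    r' = (x, y) ∨ (r' = (x + 1, y) ∧ x + 1 ≤ y) ∨ r' = (x, y + 1) := by
  obtain ⟨h | h | h, -, h'⟩ := h
  · exact .inl h
  · rw [dir_of_lt (by simpa using hx.trans hxy) hy] at h
    subst h
    simp only [Diamond, sigma] at h'
    exact .inr (.inl ⟨rfl, by omega⟩)
  · rw [dir_of_lt hx (by simpa using hxy.trans_lt hy)] at h
    exact .inr (.inr h)

open Classical in
/-- A cop aligned with the robber between him and his way out wins with a chaser's help. -/
theorem force_of_aligned (hk : 0 < k) {g e : ι} (hge : g ≠ e) (N : ℕ) :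
    ∀ (x y y' : ℤ) (p : ι → ℤ × ℤ), 0 ≤ x → x ≤ y → y ≤ y' → y' < k → p g = (x, y') →
      (y' - y) + (k - x) ≤ N →
      Force (DiamondMove k) (GridMove k) (fun p r => ∃ i, p i = r) p (x, y) := by
  induction N with
  | zero => intros; omega
  | succ N ih =>
    intro x y y' p hx hxy hyy hy hg hN
    push_cast at hN
    -- A robber who stays lets the chaser `e` advance, which shortens `L`; any other move lowers the
    -- outer bound `N`.
    obtain ⟨L, hL⟩ := Steps.exists_of_reflTransGen (GridMove.connected hk (p e) (x, y))
    induction L generalizing p with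
    | zero => exact .goal ⟨e, hL⟩
    | succ L ihL =>
      obtain ⟨w, hw, hL⟩ := hL
      by_cases hc : y = y'
      · exact .goal ⟨g, by rw [hg, hc]⟩
      refine .of_forall fun r' hr => ?_
      rcases diamondMove_cases hx hxy (by omega) hr with rfl | ⟨rfl, h1⟩ | rfl
      · refine ⟨Function.update p e w, fun i => ?_, ihL _ ?_ ?_⟩
        · by_cases hi : i = e
          · subst hi; simpa using hw
          · simpa [hi] using .inl rfl
        · simpa [hge] using hg
        · simpa using hL
      · refine ⟨Function.update p g (x + 1, y'), fun i => ?_, ih (x + 1) y y' _ (by omega) h1 hyy hy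
          (by simp) (by omega)⟩
        by_cases hi : i = g
        · subst hi
          rw [hg]
          exact .inr (.inl (by simp [dir_of_lt (show 0 ≤ y' by omega) hy]))
        · simpa [hi] using .inl rfl
      · exact ⟨p, fun i => .inl rfl, ih x (y + 1) y' p hx (by omega) (by omega) hy hg (by omega)⟩

open Classical in
/-- A cop on the top row of the cell, not ahead of the robber, gets aligned with him. -/
theorem force_of_guard (hk : 0 < k) {g e : ι} (hge : g ≠ e) (N : ℕ) :
    ∀ (x x' y : ℤ) (p : ι → ℤ × ℤ), 0 ≤ x' → x' ≤ x → x ≤ y → y < k → p g = (x', (k : ℤ) - 1) →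
      (x - x') + (k - x) + (k - y) ≤ N →
      Force (DiamondMove k) (GridMove k) (fun p r => ∃ i, p i = r) p (x, y) := by
  induction N with
  | zero => intros; omega
  | succ N ih =>
    intro x x' y p hx' hxx hxy hy hg hN
    push_cast at hN
    rcases eq_or_lt_of_le hxx with rfl | hlt
    · exact force_of_aligned hk hge _ x' y (k - 1) p hx' hxy (by omega) (by omega) hg
        (Int.self_le_toNat _)
    have hright : ∀ i, GridMove k (p i) (Function.update p g (x' + 1, (k : ℤ) - 1) i) := by
      intro i
      by_cases hi : i = g
      · subst hi
        rw [hg]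
        exact .inr (.inl (by simp [dir_of_lt (k := k) (z := k - 1) (by omega) (by omega)]))
      · simpa [hi] using .inl rfl
    refine .of_forall fun r' hr => ?_
    rcases diamondMove_cases (hx'.trans hxx) hxy hy hr with rfl | ⟨rfl, h1⟩ | rfl
    · exact ⟨_, hright, ih _ (x' + 1) _ _ (by omega) (by omega) hxy hy (by simp) (by omega)⟩
    · exact ⟨_, hright, ih _ (x' + 1) _ _ (by omega) (by omega) h1 hy (by simp) (by omega)⟩
    by_cases hyk : y + 1 < k
    · exact ⟨_, hright, ih _ (x' + 1) _ _ (by omega) (by omega) (by omega) hyk (by simp) (by omega)⟩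
    -- The robber leaves through the top. The guard steps up too and, after a quarter turn back,
    -- stands above him in column `0`.
    obtain rfl : y = k - 1 := by omega
    refine ⟨Function.update p g (x', (k : ℤ)), fun i => ?_, force_of_rot_symm hk ?_⟩
    · by_cases hi : i = g
      · subst hi
        rw [hg]
        exact .inr (.inr (by simp [dir_of_lt hx' (show x' < k by omega)]))
      · simpa [hi] using .inl rfl
    · have e : (rot k).symm (x, (k : ℤ) - 1 + 1) = (0, k - 1 - x) := by simp [rot]
      rw [e]
      exact force_of_aligned hk hge _ 0 (k - 1 - x) (k - 1 - x') _ le_rfl (by omega) (by omega)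
        (by omega) (by simp [rot]) (Int.self_le_toNat _)

/-- Four cops capture a robber who is confined to the diamond. -/
theorem force_diamond (hk : 0 < k) (p : Fin 4 → ℤ × ℤ) (r : ℤ × ℤ) :
    Force (DiamondMove k) (GridMove k) (fun p r => ∃ i, p i = r) p r := by
  -- The four vertices around the vortex, an orbit of `rot`: one guard for each cell.
  refine (Force.walk (f := ![(0, (k : ℤ) - 1), (0, k), (-1, k), (-1, k - 1)])
    (fun _ => .inl rfl) fun i => GridMove.connected hk _ _).trans ?_
  rintro _ r rfl
  by_cases hd : Diamond k r
  swap
  -- Outside the diamond `DiamondMove` allows nothing, not even staying.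
  · exact .of_forall fun r' hr => absurd hr.2.1 hd
  have first : ∀ (p : Fin 4 → ℤ × ℤ) (g e : Fin 4) (r : ℤ × ℤ), g ≠ e → p g = (0, (k : ℤ) - 1) →
      Diamond k r → 0 ≤ r.1 → r.2 < k →
      Force (DiamondMove k) (GridMove k) (fun p r => ∃ i, p i = r) p r := by
    rintro p g e ⟨x, y⟩ hge hp h h1 h2
    simp only [Diamond, sigma] at h h1 h2
    exact force_of_guard hk hge _ x 0 y p le_rfl h1 (by omega) h2 hp (Int.self_le_toNat _)
  rcases lt_or_ge r.2 k with h2 | h2 <;> rcases lt_or_ge r.1 0 with h1 | h1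
  · refine force_of_rot_symm hk (force_of_rot_symm hk (force_of_rot_symm hk
      (first _ 3 0 _ (by decide) ?_ hd.rot_symm.rot_symm.rot_symm ?_ ?_))) <;>
      simp [rot] <;> omega
  · exact first _ 0 1 _ (by decide) rfl hd h1 h2
  · refine force_of_rot_symm hk (force_of_rot_symm hk
      (first _ 2 0 _ (by decide) ?_ hd.rot_symm.rot_symm ?_ ?_)) <;>
      simp [rot] <;> omega
  · refine force_of_rot_symm hk (first _ 1 0 _ (by decide) ?_ hd.rot_symm ?_ ?_) <;>
      simp [rot] <;> omega

/-- Four cops capture the robber up to folding both diagonal coordinates. -/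
theorem force_foldCaught (hk : 0 < k) (p : Fin 4 → ℤ × ℤ) (r : ℤ × ℤ) :
    Force (GridMove k) (GridMove k)
      (FoldCaught tau (fun p q => FoldEq (2 * k) (sigma p) (sigma q)) (2 * k)) p r := by
  obtain ⟨s, hs, hs0, hs1⟩ := exists_foldEq_mem (show 0 < 2 * (k : ℤ) by omega) (sigma r)
  obtain ⟨t, ht, ht0, ht1⟩ := exists_foldEq_mem (show 0 < 2 * (k : ℤ) by omega) (tau r)
  -- A vertex with diagonal coordinates `s`, `t` requires this parity, which folding preserves.
  have hpar : 2 ∣ t - 1 - s := by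
    obtain ⟨z, hz⟩ := hs
    obtain ⟨w, hw⟩ := ht
    have m : ∀ z, 2 * (2 * (k : ℤ)) * z = 4 * (k * z) := fun z => by ring
    simp only [m, sigma, tau] at hz hw
    omega
  obtain ⟨x, hx⟩ := hpar
  -- Here `q` is the folded image, which follows the robber `r` inside the diamond while the cops
  -- play against `q`.
  suffices H : ∀ (p : Fin 4 → ℤ × ℤ) (q : ℤ × ℤ),
      Force (DiamondMove k) (GridMove k) (fun p r => ∃ i, p i = r) p q → ∀ r, Diamond k q →
      FoldEq (2 * k) (sigma q) (sigma r) → FoldEq (2 * k) (tau q) (tau r) →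
      Force (GridMove k) (GridMove k)
        (FoldCaught tau (fun p q => FoldEq (2 * k) (sigma p) (sigma q)) (2 * k)) p r by
    have e1 : sigma (x, x + s) = s := by simp [sigma]
    have e2 : tau (x, x + s) = t := by simp only [tau]; omega
    refine H p (x, x + s) (force_diamond hk _ _) r ?_ ?_ ?_
    · rw [Diamond, e1, e2]
      exact ⟨hs0, hs1, ht0, ht1⟩
    · rwa [e1]
    · rwa [e2]
  clear hs hs0 hs1 ht ht0 ht1 hx p r
  intro p q hF
  induction hF with
  | goal h =>
    intro r _ h1 h2
    obtain ⟨i, rfl⟩ := h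
    exact .goal ⟨i, h1, h2⟩
  | @step p q f hf _ ih =>
    intro r hq h1 h2
    refine .of_forall fun r' hr => ?_
    have hk' : 0 < 2 * (k : ℤ) := by omega
    obtain ⟨u, hu, hu1, hu2, hu3, hu4⟩ := h1.exists_mem_strip hk' (j := 0)
      (by simpa using hq.1) (by simpa using hq.2.1) hr.sigma_le.1 hr.sigma_le.2
    obtain ⟨w, hw, hw1, hw2, hw3, hw4⟩ := h2.exists_mem_strip hk' (j := 0)
      (by simpa using hq.2.2.1) (by simpa using hq.2.2.2) hr.tau_le.1 hr.tau_le.2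
    obtain ⟨q', hq', rfl, rfl⟩ := hr.lift hk h1 h2 hu hw hu1 hu2 hw1 hw2
    have hd : Diamond k q' := ⟨by simpa using hu3, by simpa using hu4, by simpa using hw3,
      by simpa using hw4⟩
    exact ⟨f q', hf q' ⟨hq', hq, hd⟩, ih q' ⟨hq', hq, hd⟩ r' hd hu hw⟩

/-- Eight cops capture the robber on the infinite grid up to periods. -/
theorem force_grid (hk : 0 < k) {m : ℤ} (hm : 0 < m) (p : (Fin 4 ⊕ Bool) ⊕ Bool → ℤ × ℤ)
    (r : ℤ × ℤ) :
    Force (GridMove k) (GridMove k) (fun p r => ∃ i, 2 * (2 * k) * m ∣ tau (p i) - tau r ∧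
      2 * (2 * k) * m ∣ sigma (p i) - sigma r) p r := by
  have hk' : 0 < 2 * (k : ℤ) := by omega
  refine (isMirrored_sigma hk m).force_caught hk' (fun p r => ?_) hm p r
  refine ((isMirrored_tau hk).force_caught hk' (force_foldCaught hk) hm p r).mono ?_
  rintro p r ⟨i, h1, h2⟩
  exact ⟨i, h2, h1⟩

end Pursuit

/-! ## From forcing a capture to the cop number -/

namespace Pursuit

open CopsAndRobbers

/-- A strategy on a cover of a digraph bounds its cop number. -/
theorem copNumber_le_of_force {X V ι : Type*} {D : Digraph V} {R C : X → X → Prop}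
    {G : (ι → X) → X → Prop} {c : ℕ} (e : Fin c ≃ ι) (π : X → V) (hπ : Function.Surjective π)
    (hR : ∀ r v, Move D (π r) v → ∃ r', R r r' ∧ π r' = v)
    (hC : ∀ p q, C p q → Move D (π p) (π q)) (hG : ∀ p r, G p r → ∃ i, π (p i) = π r)
    (p : ι → X) (h : ∀ r, Force R C G p r) : copNumber D ≤ c := by
  have key : ∀ p r, Force R C G p r → (∃ i, π (p i) = π r) ∨
      ∀ v, Move D (π r) v → ForceCapture D (fun i => π (p (e i))) v := by
    intro p r hF
    induction hF with
    | goal h => exact .inl (hG _ _ h)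
    | @step p r f hf _ ih =>
      refine .inr fun v hv => ?_
      obtain ⟨r', hr, rfl⟩ := hR _ _ hv
      refine .step (fun i => π (f r' (e i))) (fun i => hC _ _ (hf r' hr (e i))) ?_
      intro v hne hv
      rcases ih r' hr with ⟨i, hi⟩ | h
      · exact absurd hi (by simpa using hne (e.symm i))
      · exact h v hv
  refine iInf₂_le c ⟨fun i => π (p (e i)), fun v => ?_⟩
  obtain ⟨r, rfl⟩ := hπ v
  rcases key p r (h r) with ⟨i, hi⟩ | h
  · exact .caught (e.symm i) (by simpa using hi)
  -- `Force` has the robber to move but the cops start, so his choice of vertex is followed by a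
  -- fictitious stay.
  · exact h _ (.inl rfl)

/-! ## Lines that all have the same direction -/

/-- Three cops win on a Cayley digraph of an abelian group with two generators. -/
theorem force_cayley {V : Type*} [AddCommGroup V] {M : V → V → Prop} {s t : V}
    (hM : ∀ u v, M u v ↔ v = u ∨ v = u + s ∨ v = u + t) (N : ℕ) :
    ∀ (a b c d e f : ℕ) (p : Fin 3 → V) (r : V), a + b + c + d + e + f ≤ N →
      p 0 = r - a • s - b • t → p 1 = r + c • s + d • (s - t) → p 2 = r + e • t + f • (t - s) →
      Force M M (fun p r => ∃ i, p i = r) p r := by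
  induction N with
  | zero =>
    intro a b c d e f p r hN h0 _ _
    obtain ⟨rfl, rfl⟩ : a = 0 ∧ b = 0 := by omega
    exact .goal ⟨0, by simp [h0]⟩
  | succ N ih =>
    intro a b c d e f p r hN h0 h1 h2
    refine .of_forall fun r' hr => ?_
    rcases (hM _ _).1 hr with rfl | rfl | rfl
    · rcases a with _ | a
      · rcases b with _ | b
        · exact ⟨p, fun i => (hM _ _).2 (.inl rfl), .goal ⟨0, by simp [h0]⟩⟩
        · refine ⟨![p 0 + t, p 1, p 2], fun i => ?_, ih 0 b c d e f _ _ (by omega) ?_ h1 h2⟩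
          · fin_cases i <;> simp [hM]
          · simp only [Matrix.cons_val_zero, h0]; module
      · refine ⟨![p 0 + s, p 1, p 2], fun i => ?_, ih a b c d e f _ _ (by omega) ?_ h1 h2⟩
        · fin_cases i <;> simp [hM]
        · simp only [Matrix.cons_val_zero, h0]; module
    -- Cops 0 and 2 copy the step `s`. Cop 1 stays, lowering `c`, or plays `t`, lowering `d`. The
    -- step `t` is symmetric.
    · rcases c with _ | c
      · rcases d with _ | d
        · refine ⟨fun i => p i + s, fun i => (hM _ _).2 (.inr (.inl rfl)), .goal ⟨1, by simp [h1]⟩⟩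
        · refine ⟨![p 0 + s, p 1 + t, p 2 + s], fun i => ?_,
            ih a b 0 d e f _ _ (by omega) ?_ ?_ ?_⟩
          · fin_cases i <;> simp [hM]
          all_goals
            simp only [Matrix.cons_val_zero, Matrix.cons_val_one, Matrix.cons_val, h0, h1, h2]
            module
      · refine ⟨![p 0 + s, p 1, p 2 + s], fun i => ?_, ih a b c d e f _ _ (by omega) ?_ ?_ ?_⟩
        · fin_cases i <;> simp [hM]
        all_goals
          simp only [Matrix.cons_val_zero, Matrix.cons_val_one, Matrix.cons_val, h0, h1, h2]
          module
    · rcases e with _ | e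
      · rcases f with _ | f
        · refine ⟨fun i => p i + t, fun i => (hM _ _).2 (.inr (.inr rfl)), .goal ⟨2, by simp [h2]⟩⟩
        · refine ⟨![p 0 + t, p 1 + t, p 2 + s], fun i => ?_,
            ih a b c d 0 f _ _ (by omega) ?_ ?_ ?_⟩
          · fin_cases i <;> simp [hM]
          all_goals
            simp only [Matrix.cons_val_zero, Matrix.cons_val_one, Matrix.cons_val, h0, h1, h2]
            module
      · refine ⟨![p 0 + t, p 1 + t, p 2], fun i => ?_, ih a b c d e f _ _ (by omega) ?_ ?_ ?_⟩
        · fin_cases i <;> simp [hM]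
        all_goals
          simp only [Matrix.cons_val_zero, Matrix.cons_val_one, Matrix.cons_val, h0, h1, h2]
          module

end Pursuit

/-! ## The structure of regularly oriented toroidal grids -/

namespace ToroidalGrid

open CopsAndRobbers Pursuit

variable {n : ℕ} {D : Digraph (ZMod n × ZMod n)}

open Classical in
/-- The direction of a line, as an increment of the coordinate. -/
noncomputable def lineDir (D : Digraph (ZMod n × ZMod n)) (L : Line n) : ZMod n :=
  if Forward D L then 1 else -1

theorem IsStraightAhead.backward_iff (hD : IsStraightAhead D) (L : Line n) :
    Backward D L ↔ ¬ Forward D L :=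
  ⟨fun h h' => hD.1.2 _ _ (h' 0) (h 0), (hD.2 L).resolve_left⟩

theorem IsStraightAhead.adj_vertex (hD : IsStraightAhead D) (L : Line n) (t : ZMod n) :
    D.Adj (L.vertex t) (L.vertex (t + lineDir D L)) := by
  unfold lineDir
  split_ifs with h
  · exact h t
  · have := (hD.backward_iff L).2 h (t - 1)
    rwa [sub_add_cancel, sub_eq_add_neg] at this

theorem IsStraightAhead.eq_of_adj (hD : IsStraightAhead D) (L : Line n) {t s : ZMod n}
    (h : D.Adj (L.vertex t) (L.vertex s)) (hs : s = t + 1 ∨ t = s + 1) :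
    s = t + lineDir D L := by
  unfold lineDir
  split_ifs with hL
  · rcases hs with rfl | rfl
    · rfl
    · exact absurd h (hD.1.2 _ _ (hL s))
  · rcases hs with rfl | rfl
    · exact absurd h (hD.1.2 _ _ ((hD.backward_iff L).2 hL t))
    · ring

theorem IsStraightAhead.move_iff (hD : IsStraightAhead D) (x y : ZMod n) (v : ZMod n × ZMod n) :
    Move D (x, y) v ↔ v = (x, y) ∨ v = (x + lineDir D (.row y), y) ∨
      v = (x, y + lineDir D (.col x)) := by
  refine or_congr_right ⟨fun h => ?_, ?_⟩
  · obtain ⟨x', y'⟩ := v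
    have hg := (hD.1.1 _ _).2 (.inl h)
    simp only [grid, cycle, SimpleGraph.boxProd_adj, SimpleGraph.circulantGraph_adj,
      Set.mem_singleton_iff] at hg
    rcases hg with ⟨⟨-, hx⟩, rfl⟩ | ⟨⟨-, hy⟩, rfl⟩
    · left
      rw [Prod.mk.injEq]
      refine ⟨hD.eq_of_adj (.row y) h ?_, rfl⟩
      rcases hx with hx | hx
      · right; linear_combination hx
      · left; linear_combination hx
    · right
      rw [Prod.mk.injEq]
      refine ⟨rfl, hD.eq_of_adj (.col x) h ?_⟩
      rcases hy with hy | hy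
      · right; linear_combination hy
      · left; linear_combination hy
  · rintro (rfl | rfl)
    · exact hD.adj_vertex (.row y) x
    · exact hD.adj_vertex (.col x) y

theorem IsStraightAhead.isStream_iff (hD : IsStraightAhead D) (S : Set (Line n)) :
    IsStream D S ↔ Consecutive S ∧ ∀ L ∈ S, ∀ L' ∈ S, Forward D L → Forward D L' := by
  refine and_congr_right fun _ => ⟨?_, fun h => ?_⟩
  · rintro (h | h) L hL L' hL' hF
    · exact h L' hL'
    · exact absurd hF ((hD.backward_iff L).1 (h L hL))
  · by_cases h' : ∃ L ∈ S, Forward D L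
    · obtain ⟨L, hL, hF⟩ := h'
      exact .inl fun L' hL' => h L hL L' hL' hF
    · push Not at h'
      exact .inr fun L hL => (hD.backward_iff L).2 (h' L hL)

/-- The `w` lines of a parallel class from index `a` on. -/
def block (mk : ZMod n → Line n) (a : ZMod n) (w : ℕ) : Set (Line n) :=
  {L | ∃ i : ℕ, i < w ∧ L = mk (a + (i : ZMod n))}

variable {mk : ZMod n → Line n}

theorem consecutive_block (hmk : mk = Line.row ∨ mk = Line.col) (a : ZMod n) {w : ℕ}
    (h1 : 1 ≤ w) (hw : w ≤ n) : Consecutive (block mk a w) := by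
  rcases hmk with rfl | rfl
  · exact ⟨a, w, h1, hw, .inl rfl⟩
  · exact ⟨a, w, h1, hw, .inr rfl⟩

theorem Consecutive.exists_block (hmk : mk = Line.row ∨ mk = Line.col) {T : Set (Line n)}
    (hT : Consecutive T) {y : ZMod n} (hy : mk y ∈ T) : ∃ a w, w ≤ n ∧ T = block mk a w := by
  obtain ⟨a, w, -, hw, rfl | rfl⟩ := hT <;> rcases hmk with rfl | rfl
  · exact ⟨a, w, hw, rfl⟩
  · simp at hy
  · simp at hy
  · exact ⟨a, w, hw, rfl⟩

theorem ncard_block (hmk : mk = Line.row ∨ mk = Line.col) (a : ZMod n) {w : ℕ} (hw : w ≤ n) :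
    (block mk a w).ncard = w := by
  have hinj : Function.Injective mk := by
    rcases hmk with rfl | rfl <;> intro a b h <;> simpa using h
  have : block mk a w = (fun i : ℕ => mk (a + i)) '' (Finset.range w : Set ℕ) := by
    ext L
    simp [block, eq_comm]
  rw [this, Set.InjOn.ncard_image, Set.ncard_coe_finset, Finset.card_range]
  intro i hi j hj hij
  simp only [Finset.coe_range, Set.mem_Iio] at hi hj
  have := add_left_cancel (hinj hij)
  rw [ZMod.natCast_eq_natCast_iff'] at this
  rwa [Nat.mod_eq_of_lt (by omega), Nat.mod_eq_of_lt (by omega)] at this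

theorem eq_of_const {k : ℕ} (hn : 3 ≤ n) (hD : IsRegularlyOriented k D)
    (hmk : mk = Line.row ∨ mk = Line.col)
    (h : ∀ a b, Forward D (mk a) → Forward D (mk b)) : k = n := by
  have : NeZero n := ⟨by omega⟩
  have hall : ∀ a, mk a ∈ block mk 0 n := fun a => ⟨a.val, a.val_lt, by simp⟩
  rw [← hD.2 (block mk 0 n), ncard_block hmk _ le_rfl]
  refine ⟨(hD.1.isStream_iff _).2 ⟨consecutive_block hmk _ (by omega) le_rfl, ?_⟩, ?_⟩
  · rintro _ ⟨i, -, rfl⟩ _ ⟨j, -, rfl⟩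
    exact h _ _
  · intro T hT hST
    obtain ⟨a, w, -, rfl⟩ := hT.1.exists_block hmk (hST (hall 0))
    rintro _ ⟨i, -, rfl⟩
    exact hall _

/-- A stream that starts at a change of direction has width `k`. -/
theorem run_of_boundary {k : ℕ} (hn : 3 ≤ n) (hD : IsRegularlyOriented k D)
    (hmk : mk = Line.row ∨ mk = Line.col) {y : ZMod n}
    (hy : ¬ (Forward D (mk (y - 1)) ↔ Forward D (mk y))) :
    k < n ∧ (∀ i : ℕ, i < k → (Forward D (mk (y + i)) ↔ Forward D (mk y))) ∧
      ¬ (Forward D (mk (y + k)) ↔ Forward D (mk y)) := by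
  classical
  have hex : ∃ w : ℕ, ¬ (Forward D (mk (y + w)) ↔ Forward D (mk y)) := by
    refine ⟨n - 1, ?_⟩
    rwa [Nat.cast_sub (by omega), Nat.cast_one, ZMod.natCast_self, zero_sub, ← sub_eq_add_neg]
  obtain ⟨w, hw, hmin, hwn⟩ : ∃ w : ℕ, ¬ (Forward D (mk (y + w)) ↔ Forward D (mk y)) ∧
      (∀ i < w, (Forward D (mk (y + i)) ↔ Forward D (mk y))) ∧ w < n := by
    refine ⟨Nat.find hex, Nat.find_spec hex, fun i hi => not_not.1 (Nat.find_min hex hi), ?_⟩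
    refine lt_of_le_of_lt (Nat.find_min' hex (m := n - 1) ?_) (by omega)
    rwa [Nat.cast_sub (by omega), Nat.cast_one, ZMod.natCast_self, zero_sub, ← sub_eq_add_neg]
  have hw0 : w ≠ 0 := by
    rintro rfl
    simp at hw
  suffices hk : w = k by
    subst hk
    exact ⟨hwn, hmin, hw⟩
  rw [← hD.2 (block mk y w), ncard_block hmk _ hwn.le]
  refine ⟨(hD.1.isStream_iff _).2 ⟨consecutive_block hmk _ (by omega) hwn.le, ?_⟩, ?_⟩
  · rintro _ ⟨i, hi, rfl⟩ _ ⟨j, hj, rfl⟩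
    rw [hmin i hi, hmin j hj]
    exact id
  -- A stream containing the block contains neither line `y - 1` nor line `y + w`, as these change
  -- direction; so it starts at `y` and is no wider.
  · intro T hT hST
    have hyT : mk y ∈ T := hST ⟨0, by omega, by simp⟩
    obtain ⟨a, w', -, rfl⟩ := hT.1.exists_block hmk hyT
    have hF := ((hD.1.isStream_iff _).1 hT).2
    have hinj : Function.Injective mk := by
      rcases hmk with rfl | rfl <;> intro a b h <;> simpa using h
    obtain ⟨i, hi, hyi⟩ := id hyT
    have hyi := hinj hyi
    obtain rfl : i = 0 := by
      by_contra h0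
      have h1 : mk (y - 1) ∈ block mk a w' := by
        refine ⟨i - 1, by omega, ?_⟩
        rw [hyi, Nat.cast_sub (by omega), Nat.cast_one, add_sub_assoc]
      exact hy ⟨hF _ h1 _ hyT, hF _ hyT _ h1⟩
    obtain rfl : y = a := by simpa using hyi
    rcases le_or_gt w' w with h | h
    · rintro _ ⟨i, hi, rfl⟩
      exact ⟨i, by omega, rfl⟩
    · have h1 : mk (y + w) ∈ block mk y w' := ⟨w, h, rfl⟩
      exact absurd ⟨hF _ h1 _ hyT, hF _ hyT _ h1⟩ hw

/-- In a parallel class with both directions, the directions alternate in streams of width `k`. -/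
theorem exists_lineDir_eq {k : ℕ} (hn : 3 ≤ n) (hk : 0 < k) (hD : IsRegularlyOriented k D)
    (hmk : mk = Line.row ∨ mk = Line.col)
    (h : ¬ ∀ a b, Forward D (mk a) → Forward D (mk b)) :
    k < n ∧ ∃ y0 : ZMod n, ∀ z : ℤ, lineDir D (mk (y0 + z)) = (dir k z : ZMod n) := by
  have : NeZero n := ⟨by omega⟩
  push Not at h
  obtain ⟨a, b, ha, hb⟩ := h
  obtain ⟨y0, h0, h1⟩ : ∃ y, Forward D (mk y) ∧ ¬ Forward D (mk (y - 1)) := by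
    by_contra! hc
    have : ∀ j : ℕ, Forward D (mk (a - j)) := by
      intro j
      induction j with
      | zero => simpa using ha
      | succ j ih => simpa [sub_sub] using hc _ ih
    exact hb (by simpa using this (a - b).val)
  have key : ∀ j : ℕ, ¬ (Forward D (mk (y0 + (j * k : ℕ) - 1)) ↔
      Forward D (mk (y0 + (j * k : ℕ)))) ∧ (Forward D (mk (y0 + (j * k : ℕ))) ↔ Even j) := by
    intro j
    induction j with
    | zero => simp [h0, h1]
    | succ j ih =>
      obtain ⟨ih1, ih2⟩ := ih
      obtain ⟨-, h2, h3⟩ := run_of_boundary hn hD hmk ih1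
      have h4 := h2 (k - 1) (by omega)
      have e1 : y0 + ((j * k : ℕ) : ZMod n) + ((k - 1 : ℕ) : ZMod n) =
          y0 + (((j + 1) * k : ℕ) : ZMod n) - 1 := by
        rw [Nat.cast_sub hk]; push_cast; ring
      have e2 : y0 + ((j * k : ℕ) : ZMod n) + (k : ZMod n) =
          y0 + (((j + 1) * k : ℕ) : ZMod n) := by push_cast; ring
      rw [e1] at h4
      rw [e2] at h3
      rw [Nat.even_add_one]
      tauto
  refine ⟨(run_of_boundary hn hD hmk (y := y0) (by tauto)).1, y0, ?_⟩
  have nat : ∀ z : ℕ, lineDir D (mk (y0 + z)) = (dir k z : ZMod n) := by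
    intro z
    have h2 := (run_of_boundary hn hD hmk (key (z / k)).1).2.1 (z % k) (Nat.mod_lt _ hk)
    have e : y0 + ((z / k * k : ℕ) : ZMod n) + ((z % k : ℕ) : ZMod n) = y0 + z := by
      rw [add_assoc, ← Nat.cast_add, Nat.div_add_mod']
    rw [e, (key (z / k)).2] at h2
    have h3 : Even ((z : ℤ) / (k : ℤ)) ↔ Even (z / k) := by
      rw [← Int.natCast_div, Int.even_coe_nat]
    unfold lineDir dir
    rw [← h3] at h2
    by_cases hE : Even ((z : ℤ) / (k : ℤ))
    · rw [if_pos (h2.2 hE), if_pos hE, Int.cast_one]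
    · rw [if_neg fun h => hE (h2.1 h), if_neg hE, Int.cast_neg, Int.cast_one]
  intro z
  -- The added term makes the index nonnegative and is a multiple of both `n` and the period `2 *
  -- k`.
  obtain ⟨w, hw⟩ : ∃ w : ℕ, z + 2 * k * (n * |z|) = w := by
    refine ⟨_, (Int.toNat_of_nonneg ?_).symm⟩
    have h1 := neg_abs_le z
    have h2 : (1 : ℤ) ≤ k * n := by
      have : 1 ≤ k * n := Nat.mul_pos hk (by omega)
      exact_mod_cast this
    nlinarith [abs_nonneg z]
  have h2 := nat w
  have e : ((w : ℕ) : ZMod n) = (z : ZMod n) := by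
    rw [← Int.cast_natCast, ← hw]
    push_cast
    simp
  rwa [e, ← hw, dir_add_mul hk] at h2

theorem copNumber_le_of_const (hn : 3 ≤ n) (hD : IsStraightAhead D)
    (h1 : ∀ a b, Forward D (.row a) → Forward D (.row b))
    (h2 : ∀ a b, Forward D (.col a) → Forward D (.col b)) : copNumber D ≤ 3 := by
  have : NeZero n := ⟨by omega⟩
  have hs : ∀ y, lineDir D (.row y) = lineDir D (.row 0) := by
    intro y
    have := h1 y 0
    have := h1 0 y
    unfold lineDir
    split_ifs <;> tauto
  have ht : ∀ x, lineDir D (.col x) = lineDir D (.col 0) := by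
    intro y
    have := h2 y 0
    have := h2 0 y
    unfold lineDir
    split_ifs <;> tauto
  have hsq : ∀ L, lineDir D L * lineDir D L = 1 := by
    intro L
    unfold lineDir
    split_ifs <;> simp
  set s : ZMod n := lineDir D (.row 0) with hs'
  set t : ZMod n := lineDir D (.col 0) with ht'
  have hM : ∀ u v, Move D u v ↔ v = u ∨ v = u + (s, 0) ∨ v = u + (0, t) := by
    rintro ⟨x, y⟩ v
    rw [hD.move_iff, hs, ht]
    simp
  have hmul : ∀ x L, ∃ a : ℕ, (a : ZMod n) * lineDir D L = x := fun x L =>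
    ⟨(x * lineDir D L).val, by rw [ZMod.natCast_val, ZMod.cast_id, mul_assoc, hsq, mul_one]⟩
  have h := copNumber_le_of_force (D := D) (R := Move D) (C := Move D) (Equiv.refl (Fin 3)) id
    Function.surjective_id (fun r v hv => ⟨v, hv, rfl⟩) (fun _ _ h => h)
    (G := fun p r => ∃ i, p i = r) (fun _ _ h => h) (fun _ => (0, 0)) ?_
  · exact_mod_cast h
  rintro ⟨x, y⟩
  obtain ⟨a, ha⟩ := hmul x (.row 0)
  obtain ⟨b, hb⟩ := hmul y (.col 0)
  -- All cops start at the origin; with `d = b` and `f = a` in `force_cayley` these are the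
  -- remaining coefficients.
  obtain ⟨c, hc⟩ := hmul (-x - b * s) (.row 0)
  obtain ⟨e, he⟩ := hmul (-y - a * t) (.col 0)
  rw [← hs'] at ha hc
  rw [← ht'] at hb he
  refine force_cayley hM _ a b c b e a _ _ le_rfl ?_ ?_ ?_
  · ext <;> simp [ha, hb]
  · ext <;> simp [hc, hb]; ring
  · ext <;> simp [he, ha]; ring

end ToroidalGrid

theorem mainTheorem3 (n k : ℕ) (hn : 3 ≤ n) (hk : 2 ≤ k)
    (D : Digraph (ZMod n × ZMod n)) (hD : ToroidalGrid.IsRegularlyOriented k D) :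
    CopsAndRobbers.copNumber D ≤ 13 := by
  open ToroidalGrid Pursuit in
  have hk0 : 0 < k := by omega
  by_cases hr : ∀ a b, Forward D (.row a) → Forward D (.row b)
  · by_cases hc : ∀ a b, Forward D (.col a) → Forward D (.col b)
    · exact (copNumber_le_of_const hn hD.1 hr hc).trans (by norm_num)
    · have h1 := eq_of_const hn hD (.inl rfl) hr
      have h2 := (exists_lineDir_eq hn hk0 hD (.inr rfl) hc).1
      omega
  by_cases hc : ∀ a b, Forward D (.col a) → Forward D (.col b)
  · have h1 := eq_of_const hn hD (.inr rfl) hc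
    have h2 := (exists_lineDir_eq hn hk0 hD (.inl rfl) hr).1
    omega
  obtain ⟨-, y0, hy⟩ := exists_lineDir_eq hn hk0 hD (.inl rfl) hr
  obtain ⟨-, x0, hx⟩ := exists_lineDir_eq hn hk0 hD (.inr rfl) hc
  have hmove : ∀ (p : ℤ × ℤ) v, CopsAndRobbers.Move D (x0 + p.1, y0 + p.2) v ↔
      ∃ q, GridMove k p q ∧ ((x0 + q.1, y0 + q.2) : ZMod n × ZMod n) = v := by
    intro p v
    rw [hD.1.move_iff, hy, hx]
    constructor
    · rintro (rfl | rfl | rfl)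
      · exact ⟨p, .inl rfl, rfl⟩
      · exact ⟨_, .inr (.inl rfl), by push_cast; rw [add_assoc]⟩
      · exact ⟨_, .inr (.inr rfl), by push_cast; rw [add_assoc]⟩
    · rintro ⟨q, rfl | rfl | rfl, rfl⟩
      · exact .inl rfl
      · exact .inr (.inl (by push_cast; rw [add_assoc]))
      · exact .inr (.inr (by push_cast; rw [add_assoc]))
  have h := copNumber_le_of_force (D := D) (c := 8)
    (Fintype.equivOfCardEq (by simp) : Fin 8 ≃ (Fin 4 ⊕ Bool) ⊕ Bool)
    (fun p : ℤ × ℤ => ((x0 + p.1, y0 + p.2) : ZMod n × ZMod n)) ?_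
    (fun r v => (hmove r v).1) (fun p q h => (hmove p _).2 ⟨q, h, rfl⟩) ?_ (fun _ => (0, 0))
    (fun r => force_grid hk0 (m := n) (by omega) _ r)
  · exact h.trans (by norm_num)
  · rintro ⟨x, y⟩
    obtain ⟨a, ha⟩ := ZMod.intCast_surjective (x - x0)
    obtain ⟨b, hb⟩ := ZMod.intCast_surjective (y - y0)
    exact ⟨(a, b), by simp [ha, hb]⟩
  · rintro p r ⟨i, ⟨z, hz⟩, ⟨w, hw⟩⟩
    simp only [tau, sigma] at hz hw
    -- Returning from diagonal coordinates halves the period `4kn`, which leaves a multiple of `n`.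
    have e1 : (p i).1 = r.1 + n * (2 * k * (z - w)) := by linarith
    have e2 : (p i).2 = r.2 + n * (2 * k * (z + w)) := by linarith
    refine ⟨i, ?_⟩
    simp [e1, e2]
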